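/- Consider the periodic-review, single-product partial backorder inventory system with zero lead time. The demands $D_1,D_2,\dots$ are i.i.d. nonnegative-integer-valued random variables with finite mean; $\xi_{i;\ell}$ ($i,\ell\ge 1$) are i.i.d. Bernoulli random variables with mean $p\in[0,1]$, independent of the demands; $r>0$ is the unit sale price and $h>0$ is the unit holding cost per period. At the beginning of period $i$ the on-hand inventory $I_i$ and the backorder $B_{i-1}$ are observed, and a quantity $Q_i\in\{0,1,2,\dots\}$, a function of $(I_i,B_{i-1})$ that may depend on $i$, is ordered and arrives at once. Then $D_i$ is realized, the unmet demand is $U_i=(B_{i-1}+D_i-I_i-Q_i)^+$, and $$B_i=\sum_{\ell=1}^{U_i}\xi_{i;\ell},\qquad I_{i+1}=(I_i+Q_i-B_{i-1}-D_i)^+,$$ while the remaining $U_i-B_i$ units of demand are lost. A sequence $\pi=(Q_1,Q_2,\dots)$ of such order rules is an admissible policy. The expected profit of period $i$ for given $(I_i,B_{i-1},Q_i)$ is $$\Pi_i^\pi=\mathbb E_{D_i}\big[r\,\min(I_i+Q_i,\;B_{i-1}+D_i)-h\,(I_i+Q_i-B_{i-1}-D_i)^+\big],$$ where the expectation is over $D_i$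 only, and the long-run average profit of $\pi$ from an initial state ${\bf x}=(I_1,B_0)$ of nonnegative integers with $I_1B_0=0$ is $$\mathcal C^\pi(r,h;{\bf x})=\liminf_{N\to\infty}\frac1N\,\mathbb E\Big[\sum_{i=1}^N\Pi_i^\pi\;\Big|\;(I_1,B_0)={\bf x}\Big]\in[-\infty,\infty].$$ The base-stock policy with level $s$ orders $Q_i=(s-I_i+B_{i-1})^+$ in every period $i$. Theorem. The minimum $$s^*=\min\Big\{x\in\{0,1,2,\dots\}:\ \mathbb P[D_1\le x]\ \ge\ \frac{(1-p)r}{(1-p)r+h}\Big\}$$ exists, and the base-stock policy with level $s^*$ is optimal: for every initial state ${\bf x}$ as above, its long-run average profit from ${\bf x}$ is at least that of every admissible policy. -/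

import Mathlib

open MeasureTheory ProbabilityTheory Filter

noncomputable section

namespace PartialBackorder

variable {Ω : Type*} [MeasurableSpace Ω]

/-- The random primitives of the partial backorder system, with periods numbered `0, 1, 2, …`
(index `n` is period `n + 1`) and the customers left unserved in a period numbered `0, 1, 2, …`.
`D n` is the demand of period `n`; `ξ n l` is `1` if the `l`-th unserved customer of period `n`
stays (is backordered) and `0` if she leaves (is lost). The demands are i.i.d. with finite mean, the
`ξ n l` are Bernoulli with mean `p`, and all these random variables are mutually independent. -/
structure IsPrimitives (μ : Measure Ω) (p : ℝ) (D : ℕ → Ω → ℕ) (ξ : ℕ → ℕ → Ω → ℕ) : Prop where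
  measurable_demand : ∀ n, Measurable (D n)
  measurable_stay : ∀ n l, Measurable (ξ n l)
  identDistrib_demand : ∀ n, IdentDistrib (D n) (D 0) μ μ
  integrable_demand : Integrable (fun ω => (D 0 ω : ℝ)) μ
  stay_one : ∀ n l, μ {ω | ξ n l ω = 1} = ENNReal.ofReal p
  stay_zero : ∀ n l, μ {ω | ξ n l ω = 0} = ENNReal.ofReal (1 - p)
  indep : iIndepFun (fun j : ℕ ⊕ ℕ × ℕ => Sum.elim D (fun q : ℕ × ℕ => ξ q.1 q.2) j) μ

/-- An admissible order policy for lead time zero: the order quantity `π n I B` of period `n` is a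
function of the observed on-hand inventory `I` and the observed backorder `B`. -/
abbrev Policy : Type := ℕ → ℕ → ℕ → ℕ

/-- The base-stock policy with level `s`: order `(s - IP)⁺`, where `IP = I - B` is the inventory
position. -/
def baseStock (s : ℤ) : Policy := fun _ I B => (s - ((I : ℤ) - (B : ℤ))).toNat

/-- The state (on-hand inventory, backorder) at the beginning of period `n` under the policy `π`,
from the initial state `(I₁, B₀)`. The order `Q` arrives at once, the unmet demand is
`U = (B + D - I - Q)⁺`, of which `ξ n 0 + ⋯ + ξ n (U - 1)` is backordered, and the inventory left
over is `(I + Q - B - D)⁺`; subtraction on `ℕ` is truncated at `0`. -/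
def state (D : ℕ → Ω → ℕ) (ξ : ℕ → ℕ → Ω → ℕ) (π : Policy) (I₁ B₀ : ℕ) : ℕ → Ω → ℕ × ℕ
  | 0, _ => (I₁, B₀)
  | n + 1, ω =>
    let I := (state D ξ π I₁ B₀ n ω).1
    let B := (state D ξ π I₁ B₀ n ω).2
    let Q := π n I B
    let U := (B + D n ω) - (I + Q)
    ((I + Q) - (B + D n ω), ∑ l ∈ Finset.range U, ξ n l ω)

/-- The expected profit of period `n`, for given on-hand inventory `I`, backorder `B` and order
quantity `Q`; the expectation is over the demand `D n`. -/
def periodProfit (μ : Measure Ω) (r h : ℝ) (D : ℕ → Ω → ℕ) (n I B Q : ℕ) : ℝ :=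
  ∫ ω, (r * min ((I : ℝ) + Q) ((B : ℝ) + D n ω)
    - h * max ((I : ℝ) + Q - B - D n ω) 0) ∂μ

/-- The total of the expected period profits over the first `N` periods, as a random variable (a
function of the states visited). -/
def totalProfit (μ : Measure Ω) (r h : ℝ) (D : ℕ → Ω → ℕ) (ξ : ℕ → ℕ → Ω → ℕ) (π : Policy)
    (I₁ B₀ N : ℕ) (ω : Ω) : ℝ :=
  ∑ n ∈ Finset.range N,
    periodProfit μ r h D n (state D ξ π I₁ B₀ n ω).1 (state D ξ π I₁ B₀ n ω).2
      (π n (state D ξ π I₁ B₀ n ω).1 (state D ξ π I₁ B₀ n ω).2)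

/-- The expectation `E[f⁺] - E[f⁻]` of a real random variable as an extended real number. (An
admissible policy may order so much that its expected holding cost is infinite; the expected profit
is then `-∞`.) -/
def expect (μ : Measure Ω) (f : Ω → ℝ) : EReal :=
  ((∫⁻ ω, ENNReal.ofReal (f ω) ∂μ : ENNReal) : EReal)
    - ((∫⁻ ω, ENNReal.ofReal (-f ω) ∂μ : ENNReal) : EReal)

/-- The long-run average profit of the policy `π` from the initial state `(I₁, B₀)`. -/
def avgProfit (μ : Measure Ω) (r h : ℝ) (D : ℕ → Ω → ℕ) (ξ : ℕ → ℕ → Ω → ℕ) (π : Policy)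
    (I₁ B₀ : ℕ) : EReal :=
  liminf (fun N : ℕ => expect μ (totalProfit μ r h D ξ π I₁ B₀ N) / (N : EReal)) atTop

/-- `π` maximizes the long-run average profit among all admissible policies, from every initial
state `(I₁, B₀)` with `I₁ * B₀ = 0`. -/
def IsOptimal (μ : Measure Ω) (r h : ℝ) (D : ℕ → Ω → ℕ) (ξ : ℕ → ℕ → Ω → ℕ) (π : Policy) : Prop :=
  ∀ I₁ B₀ : ℕ, I₁ * B₀ = 0 → ∀ π' : Policy,
    avgProfit μ r h D ξ π' I₁ B₀ ≤ avgProfit μ r h D ξ π I₁ B₀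

end PartialBackorder

end

noncomputable section

namespace PartialBackorder

/-! ### Expectations in the extended reals -/

section Expect

variable {Ω : Type*} [MeasurableSpace Ω] {μ : Measure Ω}

/-! Let `y = I + Q - B` be the inventory position after ordering and `U` the unmet demand. Sales are
`B + D - U`. Splitting the lost revenue `r U` into `p r U` and `(1 - p) r U` writes the profit as
`(r B - r p U) + (r D - b U - h (y - D)⁺)` with `b = (1 - p) r`. By Wald's identity the next
backorder has mean `p E[U]`, so the expectations of the first bracket telescope to `r B₀ - r E[B_N]`
(`integral_transferProfit`). The second has conditional mean `r E[D] - G(y)`, with `G` the convex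
newsvendor cost.

Hence no policy averages more than `r E[D] - min G`, and the least `b / (b + h)` fractile `s`
minimizes `G` (`newsvendorCost_min`). Base stock at `s` keeps `E[B_N]` bounded and holds the
position at `s` up to an excess that demand wears down. The total expected excess is finite when
`P(D > 0) > 0`, so the bound is attained.

If demand vanishes almost surely and `I₁ > s`, the level `s` is never reached. Then every position
is at least `I₁`, base stock stays at `I₁`, and `G` is smallest there among the attainable
positions. -/

theorem expect_mono {f g : Ω → ℝ} (hfg : ∀ᵐ ω ∂μ, f ω ≤ g ω) : expect μ f ≤ expect μ g := by
  refine EReal.sub_le_sub ?_ ?_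
  · exact EReal.coe_ennreal_le_coe_ennreal_iff.2
      (lintegral_mono_ae (hfg.mono fun ω hω => ENNReal.ofReal_le_ofReal hω))
  · exact EReal.coe_ennreal_le_coe_ennreal_iff.2
      (lintegral_mono_ae (hfg.mono fun ω hω => ENNReal.ofReal_le_ofReal (neg_le_neg hω)))

theorem expect_of_integrable {f : Ω → ℝ} (hf : Integrable f μ) :
    expect μ f = ((∫ ω, f ω ∂μ : ℝ) : EReal) := by
  have h1 : ∫⁻ ω, ENNReal.ofReal (f ω) ∂μ ≠ ⊤ := hf.lintegral_lt_top.ne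
  have h2 : ∫⁻ ω, ENNReal.ofReal (-f ω) ∂μ ≠ ⊤ := hf.neg.lintegral_lt_top.ne
  rw [integral_eq_lintegral_pos_part_sub_lintegral_neg_part hf, EReal.coe_sub,
    EReal.coe_ennreal_toReal h1, EReal.coe_ennreal_toReal h2, expect]

theorem tendsto_affine_div (c g : ℝ) :
    Tendsto (fun N : ℕ => ((c + N * g : ℝ) : EReal) / (N : EReal)) atTop (nhds (g : EReal)) := by
  have h1 : Tendsto (fun N : ℕ => c / (N : ℝ) + g) atTop (nhds (0 + g)) :=
    (tendsto_const_div_atTop_nhds_zero_nat c).add_const g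
  rw [zero_add] at h1
  refine (EReal.tendsto_coe.2 h1).congr' ?_
  filter_upwards [eventually_gt_atTop 0] with N hN
  have : (N : ℝ) ≠ 0 := by positivity
  rw [← EReal.coe_coe_eq_natCast, ← EReal.coe_div]
  congr 1
  field_simp

/-- Turns a bound for each finite horizon into one for the long-run average; the boundary constant
`c` washes out. -/
theorem liminf_div_le {u : ℕ → EReal} {c g : ℝ} (hu : ∀ N : ℕ, u N ≤ ((c + N * g : ℝ) : EReal)) :
    liminf (fun N : ℕ => u N / (N : EReal)) atTop ≤ g := by
  rw [← (tendsto_affine_div c g).liminf_eq]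
  exact liminf_le_liminf (.of_forall fun N => EReal.div_le_div_right_of_nonneg (by positivity) (hu N))

theorem le_liminf_div {u : ℕ → EReal} {c g : ℝ} (hu : ∀ N : ℕ, ((c + N * g : ℝ) : EReal) ≤ u N) :
    (g : EReal) ≤ liminf (fun N : ℕ => u N / (N : EReal)) atTop := by
  rw [← (tendsto_affine_div c g).liminf_eq]
  exact liminf_le_liminf (.of_forall fun N => EReal.div_le_div_right_of_nonneg (by positivity) (hu N))

end Expect

/-! ### Averaging over an independent variable -/

section Independence

variable {Ω : Type*} [MeasurableSpace Ω] {μ : Measure Ω} [IsProbabilityMeasure μ]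
  {α β : Type*} [MeasurableSpace α] [MeasurableSpace β] {X : Ω → α} {Y : Ω → β} {f : α × β → ℝ}

/-- Independence makes the joint law a product, so Fubini allows averaging over `Y` with `X` frozen.
-/
theorem integrable_integral_of_indepFun (hX : Measurable X) (hY : Measurable Y)
    (hXY : IndepFun X Y μ) (hf : Measurable f) (hint : Integrable (fun ω => f (X ω, Y ω)) μ) :
    Integrable (fun ω => ∫ ω', f (X ω, Y ω') ∂μ) μ := by
  have hmap := (indepFun_iff_map_prod_eq_prod_map_map hX.aemeasurable hY.aemeasurable).1 hXY
  have h1 : Integrable f ((μ.map X).prod (μ.map Y)) := by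
    rw [← hmap, integrable_map_measure hf.aestronglyMeasurable (hX.prodMk hY).aemeasurable]
    exact hint
  have : IsProbabilityMeasure (μ.map Y) := Measure.isProbabilityMeasure_map hY.aemeasurable
  refine ((h1.integral_prod_left).comp_measurable hX).congr (.of_forall fun ω => ?_)
  exact integral_map hY.aemeasurable (hf.comp measurable_prodMk_left).aestronglyMeasurable

theorem integral_eq_integral_integral_of_indepFun (hX : Measurable X) (hY : Measurable Y)
    (hXY : IndepFun X Y μ) (hf : Measurable f) (hint : Integrable (fun ω => f (X ω, Y ω)) μ) :
    ∫ ω, f (X ω, Y ω) ∂μ = ∫ ω, ∫ ω', f (X ω, Y ω') ∂μ ∂μ := by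
  have hmap := (indepFun_iff_map_prod_eq_prod_map_map hX.aemeasurable hY.aemeasurable).1 hXY
  have h1 : Integrable f ((μ.map X).prod (μ.map Y)) := by
    rw [← hmap, integrable_map_measure hf.aestronglyMeasurable (hX.prodMk hY).aemeasurable]
    exact hint
  have : IsProbabilityMeasure (μ.map X) := Measure.isProbabilityMeasure_map hX.aemeasurable
  have : IsProbabilityMeasure (μ.map Y) := Measure.isProbabilityMeasure_map hY.aemeasurable
  rw [← integral_map (φ := fun ω => (X ω, Y ω)) (hX.prodMk hY).aemeasurable
    hf.aestronglyMeasurable, hmap, integral_prod _ h1,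
    integral_map hX.aemeasurable h1.aestronglyMeasurable.integral_prod_right']
  congr 1 with ω
  exact integral_map hY.aemeasurable (hf.comp measurable_prodMk_left).aestronglyMeasurable

omit [IsProbabilityMeasure μ] in
/-- Wald's identity for a number of summands that is independent of each summand. -/
theorem lintegral_sum_range_of_indepFun {U : Ω → ℕ} {η : ℕ → Ω → ℕ} {c : ENNReal}
    (hU : Measurable U) (hη : ∀ l, Measurable (η l)) (hind : ∀ l, IndepFun U (η l) μ)
    (hc : ∀ l, ∫⁻ ω, (η l ω : ENNReal) ∂μ = c) :
    ∫⁻ ω, ((∑ l ∈ Finset.range (U ω), η l ω : ℕ) : ENNReal) ∂μ = c * ∫⁻ ω, (U ω : ENNReal) ∂μ := by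
  have hlt (l : ℕ) : Measurable fun n : ℕ => if l < n then (1 : ENNReal) else 0 := .of_discrete
  -- As a series weighted by the indicators of `l < U`, the random sum can be integrated term by
  -- term.
  have hsum (n : ℕ) (a : ℕ → ENNReal) :
      ∑ l ∈ Finset.range n, a l = ∑' l, (if l < n then 1 else 0) * a l := by
    rw [tsum_eq_sum (s := Finset.range n) (by intro l hl; simp at hl; simp [hl.not_gt])]
    exact Finset.sum_congr rfl fun l hl => by simp [Finset.mem_range.1 hl]
  have h1 (ω : Ω) : ((∑ l ∈ Finset.range (U ω), η l ω : ℕ) : ENNReal)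
      = ∑' l, (if l < U ω then 1 else 0) * (η l ω : ENNReal) := by
    rw [← hsum, Nat.cast_sum]
  have h2 (ω : Ω) : (U ω : ENNReal) = ∑' l, if l < U ω then 1 else 0 := by
    simpa using hsum (U ω) fun _ => 1
  simp_rw [h1, h2]
  have hcast : Measurable fun n : ℕ => (n : ENNReal) := .of_discrete
  have hm1 (l : ℕ) : AEMeasurable (fun ω => if l < U ω then (1 : ENNReal) else 0) μ :=
    ((hlt l).comp hU).aemeasurable
  have hm2 (l : ℕ) : AEMeasurable (fun ω => (η l ω : ENNReal)) μ :=
    (hcast.comp (hη l)).aemeasurable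
  rw [lintegral_tsum fun l => (hm1 l).fun_mul (hm2 l), lintegral_tsum hm1, ← ENNReal.tsum_mul_left]
  congr 1 with l
  rw [mul_comm c, ← hc l]
  exact lintegral_mul_eq_lintegral_mul_lintegral_of_indepFun'' (hm1 l) (hm2 l)
    ((hind l).comp (hlt l) hcast)

end Independence

/-! ### The newsvendor function -/

section Newsvendor

variable {Ω : Type*} [MeasurableSpace Ω]

/-- The expected unmet demand when the inventory position after ordering is `y`. -/
def shortfall (μ : Measure Ω) (D : ℕ → Ω → ℕ) (y : ℝ) : ℝ :=
  ∫ ω, max ((D 0 ω : ℝ) - y) 0 ∂μ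

/-- The expected cost of lost sales and of holding when the inventory position after ordering is
`y` and each unit of unmet demand costs `b`. -/
def newsvendorCost (μ : Measure Ω) (b h : ℝ) (D : ℕ → Ω → ℕ) (y : ℝ) : ℝ :=
  ∫ ω, (b * max ((D 0 ω : ℝ) - y) 0 + h * max (y - D 0 ω) 0) ∂μ

variable {μ : Measure Ω} [IsProbabilityMeasure μ] {D : ℕ → Ω → ℕ} {b h : ℝ}

theorem integrable_shortfall (hD : Integrable (fun ω => (D 0 ω : ℝ)) μ) (y : ℝ) :
    Integrable (fun ω => max ((D 0 ω : ℝ) - y) 0) μ :=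
  (hD.sub (integrable_const y)).pos_part

theorem integrable_newsvendorCost (hD : Integrable (fun ω => (D 0 ω : ℝ)) μ) (y : ℝ) :
    Integrable (fun ω => b * max ((D 0 ω : ℝ) - y) 0 + h * max (y - D 0 ω) 0) μ :=
  ((integrable_shortfall hD y).const_mul b).add
    ((((integrable_const y).sub hD).pos_part).const_mul h)

/-- Raising the level cannot increase the shortage, and each extra unit adds at most one leftover
unit. This prices the excess over the base-stock level. -/
theorem newsvendorCost_sub_le (hb : 0 ≤ b) (hh : 0 ≤ h)
    (hD : Integrable (fun ω => (D 0 ω : ℝ)) μ) {s y : ℝ} (hsy : s ≤ y) :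
    newsvendorCost μ b h D y ≤ newsvendorCost μ b h D s + h * (y - s) := by
  have : newsvendorCost μ b h D s + h * (y - s) = ∫ ω, (b * max ((D 0 ω : ℝ) - s) 0
      + h * max (s - D 0 ω) 0 + h * (y - s)) ∂μ := by
    rw [integral_add (integrable_newsvendorCost hD s) (integrable_const _)]
    simp [newsvendorCost]
  rw [this]
  refine integral_mono (integrable_newsvendorCost hD y)
    ((integrable_newsvendorCost hD s).add (integrable_const _)) fun ω => ?_
  have h1 : max ((D 0 ω : ℝ) - y) 0 ≤ max ((D 0 ω : ℝ) - s) 0 := max_le_max (by linarith) le_rfl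
  have h2 : max (y - D 0 ω) 0 ≤ max (s - D 0 ω) 0 + (y - s) := by
    rcases max_cases (y - (D 0 ω : ℝ)) 0 with h | h <;>
      rcases max_cases (s - (D 0 ω : ℝ)) 0 with h' | h' <;> linarith
  have h3 := mul_le_mul_of_nonneg_left h1 hb
  have h4 := mul_le_mul_of_nonneg_left h2 hh
  simp only
  linarith

/-- A subgradient inequality: `A` is the event on which the holding cost is charged. -/
theorem newsvendorCost_subgradient (hb : 0 ≤ b) (hh : 0 ≤ h)
    (hD : Integrable (fun ω => (D 0 ω : ℝ)) μ) {A : Set Ω} (hA : MeasurableSet A) {s : ℝ} (y : ℝ)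
    (hle : ∀ ω ∈ A, (D 0 ω : ℝ) ≤ s) (hge : ∀ ω ∉ A, s ≤ (D 0 ω : ℝ)) :
    newsvendorCost μ b h D s + (y - s) * ((b + h) * μ.real A - b) ≤ newsvendorCost μ b h D y := by
  have hind : Integrable (A.indicator fun _ => (1 : ℝ)) μ := (integrable_const _).indicator hA
  have hslope : Integrable (fun ω => (y - s) * ((b + h) * A.indicator (fun _ => (1 : ℝ)) ω - b)) μ :=
    ((hind.const_mul _).sub (integrable_const _)).const_mul _
  have : newsvendorCost μ b h D s + (y - s) * ((b + h) * μ.real A - b)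
      = ∫ ω, (b * max ((D 0 ω : ℝ) - s) 0 + h * max (s - D 0 ω) 0
        + (y - s) * ((b + h) * A.indicator (fun _ => (1 : ℝ)) ω - b)) ∂μ := by
    rw [integral_add (integrable_newsvendorCost hD s) hslope, integral_const_mul,
      integral_sub (hind.const_mul _) (integrable_const _), integral_const_mul,
      integral_indicator_const _ hA]
    simp [newsvendorCost]
  rw [this]
  refine integral_mono ((integrable_newsvendorCost hD s).add hslope)
    (integrable_newsvendorCost hD y) fun ω => ?_
  -- Pointwise the cost has slope `h` above the demand and `-b` below it; the integrand `(b + h) 1_A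
  -- - b` selects `h` on `A` and `-b` off it.
  have h1 := mul_le_mul_of_nonneg_left (le_max_left ((D 0 ω : ℝ) - y) 0) hb
  have h2 := mul_le_mul_of_nonneg_left (le_max_left (y - (D 0 ω : ℝ)) 0) hh
  have h3 := mul_nonneg hb (le_max_right ((D 0 ω : ℝ) - y) 0)
  have h4 := mul_nonneg hh (le_max_right (y - (D 0 ω : ℝ)) 0)
  by_cases hω : ω ∈ A
  · have := hle ω hω
    simp only [Set.indicator_of_mem hω, max_eq_right (sub_nonpos.2 this),
      max_eq_left (sub_nonneg.2 this)]
    linarith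
  · have := hge ω hω
    simp only [Set.indicator_of_notMem hω, max_eq_right (sub_nonpos.2 this),
      max_eq_left (sub_nonneg.2 this)]
    linarith

/-- The event `D ≤ t` gives the right derivative `(b + h) P(D ≤ t) - b` at `t`, which is nonnegative
from the fractile on. -/
theorem newsvendorCost_mono_of_le (hb : 0 ≤ b) (hh : 0 < h) (hDm : Measurable (D 0))
    (hD : Integrable (fun ω => (D 0 ω : ℝ)) μ) {t : ℕ} {y : ℝ}
    (ht : b / (b + h) ≤ μ.real {ω | D 0 ω ≤ t}) (hty : (t : ℝ) ≤ y) :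
    newsvendorCost μ b h D t ≤ newsvendorCost μ b h D y := by
  have hA : MeasurableSet {ω | D 0 ω ≤ t} := hDm measurableSet_Iic
  have h1 := newsvendorCost_subgradient hb hh.le hD hA y (s := t)
    (fun ω (hω : D 0 ω ≤ t) => by exact_mod_cast hω)
    (fun ω (hω : ¬ D 0 ω ≤ t) => by exact_mod_cast (not_le.1 hω).le)
  rw [div_le_iff₀ (by positivity)] at ht
  have := mul_nonneg (sub_nonneg.2 hty) (sub_nonneg.2 ht)
  linarith

theorem newsvendorCost_min (hb : 0 ≤ b) (hh : 0 < h) (hDm : Measurable (D 0))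
    (hD : Integrable (fun ω => (D 0 ω : ℝ)) μ) {s : ℕ}
    (hs : IsLeast {x : ℕ | b / (b + h) ≤ μ.real {ω | D 0 ω ≤ x}} s) (y : ℝ) :
    newsvendorCost μ b h D s ≤ newsvendorCost μ b h D y := by
  rcases le_total (s : ℝ) y with hsy | hys
  · exact newsvendorCost_mono_of_le hb hh hDm hD hs.1 hsy
  -- Left of `s` the left derivative is needed, hence the strict event.
  have hA : MeasurableSet {ω | D 0 ω < s} := hDm measurableSet_Iio
  have h1 := newsvendorCost_subgradient hb hh.le hD hA y (s := s)
    (fun ω (hω : D 0 ω < s) => by exact_mod_cast hω.le)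
    (fun ω (hω : ¬ D 0 ω < s) => by exact_mod_cast not_lt.1 hω)
  have h2 : (b + h) * μ.real {ω | D 0 ω < s} - b ≤ 0 := by
    -- At `s = 0` the event is empty and the slope is `-b`. Otherwise `D < s` means `D ≤ s - 1`,
    -- where the fractile inequality fails by minimality.
    cases s with
    | zero => simpa using hb
    | succ k =>
      have hk : μ.real {ω | D 0 ω ≤ k} < b / (b + h) := by
        by_contra! hk
        have : k + 1 ≤ k := hs.2 hk
        omega
      rw [lt_div_iff₀ (by positivity)] at hk
      simp only [Nat.lt_succ_iff]
      linarith
  have := mul_nonneg_of_nonpos_of_nonpos (sub_nonpos.2 hys) h2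
  linarith

theorem exists_isLeast_fractile (hb : 0 ≤ b) (hh : 0 < h) :
    ∃ s : ℕ, IsLeast {x : ℕ | b / (b + h) ≤ μ.real {ω | D 0 ω ≤ x}} s := by
  have hmono : Monotone fun x : ℕ => {ω | D 0 ω ≤ x} := fun x y hxy ω hω => le_trans hω hxy
  have hlim : Tendsto (fun x : ℕ => μ.real {ω | D 0 ω ≤ x}) atTop (nhds 1) := by
    have := tendsto_measure_iUnion_atTop (μ := μ) hmono
    have huniv : (⋃ x : ℕ, {ω | D 0 ω ≤ x}) = Set.univ :=
      Set.eq_univ_of_forall fun ω => Set.mem_iUnion.2 ⟨D 0 ω, le_refl (D 0 ω)⟩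
    rw [huniv, measure_univ] at this
    exact (ENNReal.tendsto_toReal ENNReal.one_ne_top).comp this
  -- Since `h > 0` the fractile lies strictly below the limit `1`, so it is reached at a finite
  -- level.
  have hlt : b / (b + h) < 1 := by rw [div_lt_one (by positivity)]; linarith
  obtain ⟨x, hx⟩ := (hlim.eventually (eventually_ge_nhds hlt)).exists
  have hne : {x : ℕ | b / (b + h) ≤ μ.real {ω | D 0 ω ≤ x}}.Nonempty := ⟨x, hx⟩
  exact ⟨sInf _, Nat.sInf_mem hne, fun y hy => Nat.sInf_le hy⟩

end Newsvendor

/-! ### The state process -/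

section State

variable {Ω : Type*}

/-- The inventory position of period `n` after ordering. -/
def position (D : ℕ → Ω → ℕ) (ξ : ℕ → ℕ → Ω → ℕ) (π : Policy) (I₁ B₀ n : ℕ) (ω : Ω) : ℝ :=
  ((state D ξ π I₁ B₀ n ω).1 : ℝ)
    + π n (state D ξ π I₁ B₀ n ω).1 (state D ξ π I₁ B₀ n ω).2 - (state D ξ π I₁ B₀ n ω).2

/-- The unmet demand of period `n`. -/
def unmet (D : ℕ → Ω → ℕ) (ξ : ℕ → ℕ → Ω → ℕ) (π : Policy) (I₁ B₀ n : ℕ) (ω : Ω) : ℕ :=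
  ((state D ξ π I₁ B₀ n ω).2 + D n ω) -
    ((state D ξ π I₁ B₀ n ω).1 + π n (state D ξ π I₁ B₀ n ω).1 (state D ξ π I₁ B₀ n ω).2)

variable {D : ℕ → Ω → ℕ} {ξ : ℕ → ℕ → Ω → ℕ} {π : Policy} {I₁ B₀ : ℕ}

theorem inventory_succ (n : ℕ) (ω : Ω) :
    (state D ξ π I₁ B₀ (n + 1) ω).1 =
      ((state D ξ π I₁ B₀ n ω).1 + π n (state D ξ π I₁ B₀ n ω).1 (state D ξ π I₁ B₀ n ω).2)
        - ((state D ξ π I₁ B₀ n ω).2 + D n ω) := rfl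

theorem backorder_succ (n : ℕ) (ω : Ω) :
    (state D ξ π I₁ B₀ (n + 1) ω).2 = ∑ l ∈ Finset.range (unmet D ξ π I₁ B₀ n ω), ξ n l ω := rfl

theorem tsub_eq_max (a b : ℕ) : ((a - b : ℕ) : ℝ) = max ((a : ℝ) - b) 0 := by
  rcases le_total a b with hab | hab
  · rw [Nat.sub_eq_zero_of_le hab, max_eq_right (by simpa using hab)]; simp
  · rw [Nat.cast_sub hab, max_eq_left (by simpa using hab)]

theorem unmet_eq_max (n : ℕ) (ω : Ω) :
    (unmet D ξ π I₁ B₀ n ω : ℝ) = max ((D n ω : ℝ) - position D ξ π I₁ B₀ n ω) 0 := by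
  rw [unmet, tsub_eq_max, position]
  push_cast
  ring_nf

/-- The σ-algebra is arbitrary so that this also gives measurability with respect to the past, which
yields independence. -/
theorem measurable_state {m : MeasurableSpace Ω} (n : ℕ) (hD : ∀ k < n, Measurable[m] (D k))
    (hξ : ∀ k < n, ∀ l, Measurable[m] (ξ k l)) :
    Measurable[m] (state D ξ π I₁ B₀ n) := by
  induction n with
  | zero => exact measurable_const
  | succ n ih =>
    have hS := ih (fun k hk => hD k (by omega)) (fun k hk => hξ k (by omega))
    have hSD := hS.prodMk (hD n n.lt_succ_self)
    have hI : Measurable fun q : (ℕ × ℕ) × ℕ => (q.1.1 + π n q.1.1 q.1.2) - (q.1.2 + q.2) :=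
      .of_discrete
    have hU : Measurable fun q : (ℕ × ℕ) × ℕ => (q.1.2 + q.2) - (q.1.1 + π n q.1.1 q.1.2) :=
      .of_discrete
    have hsum : Measurable fun q : ℕ × Ω => ∑ l ∈ Finset.range q.1, ξ n l q.2 :=
      measurable_from_prod_countable_right fun k =>
        Finset.measurable_sum (Finset.range k) fun l _ => hξ n n.lt_succ_self l
    exact (hI.comp hSD).prodMk (hsum.comp ((hU.comp hSD).prodMk measurable_id))

theorem measurable_unmet {m : MeasurableSpace Ω} (n : ℕ)
    (hS : Measurable[m] (state D ξ π I₁ B₀ n)) (hD : Measurable[m] (D n)) :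
    Measurable[m] (unmet D ξ π I₁ B₀ n) := by
  have hU : Measurable fun q : (ℕ × ℕ) × ℕ => (q.1.2 + q.2) - (q.1.1 + π n q.1.1 q.1.2) :=
    .of_discrete
  exact hU.comp (hS.prodMk hD)

/-- The σ-algebra generated by the primitives with indices in `S`. -/
abbrev info (D : ℕ → Ω → ℕ) (ξ : ℕ → ℕ → Ω → ℕ) (S : Set (ℕ ⊕ ℕ × ℕ)) : MeasurableSpace Ω :=
  ⨆ j ∈ S, MeasurableSpace.comap (Sum.elim D (fun q : ℕ × ℕ => ξ q.1 q.2) j) inferInstance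

theorem measurable_info_demand {S : Set (ℕ ⊕ ℕ × ℕ)} {n : ℕ} (hn : Sum.inl n ∈ S) :
    Measurable[info D ξ S] (D n) :=
  Measurable.of_comap_le (le_iSup₂_of_le (Sum.inl n) hn le_rfl)

theorem measurable_info_stay {S : Set (ℕ ⊕ ℕ × ℕ)} {n l : ℕ} (hn : Sum.inr (n, l) ∈ S) :
    Measurable[info D ξ S] (ξ n l) :=
  Measurable.of_comap_le (le_iSup₂_of_le (Sum.inr (n, l)) hn le_rfl)

/-- The indices of the primitives that are realized before period `n`. -/
def past (n : ℕ) : Set (ℕ ⊕ ℕ × ℕ) := {j | Sum.elim id Prod.fst j < n}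

theorem measurable_info_state (n : ℕ) {S : Set (ℕ ⊕ ℕ × ℕ)}
    (hS : past n ⊆ S) : Measurable[info D ξ S] (state D ξ π I₁ B₀ n) :=
  measurable_state n (fun _ hk => measurable_info_demand (hS hk))
    (fun _ hk _ => measurable_info_stay (hS hk))

end State

/-! ### Independence from the past and mean backorders -/

namespace IsPrimitives

variable {Ω : Type*} [MeasurableSpace Ω] {μ : Measure Ω} [IsProbabilityMeasure μ] {p : ℝ}
  {D : ℕ → Ω → ℕ} {ξ : ℕ → ℕ → Ω → ℕ} {π : Policy} {I₁ B₀ : ℕ} {r h : ℝ}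

omit [IsProbabilityMeasure μ] in
theorem indepFun_of_disjoint (H : IsPrimitives μ p D ξ) {S T : Set (ℕ ⊕ ℕ × ℕ)}
    (hST : Disjoint S T) {α β : Type*} [MeasurableSpace α] [MeasurableSpace β] {X : Ω → α}
    {Y : Ω → β} (hX : Measurable[info D ξ S] X) (hY : Measurable[info D ξ T] Y) :
    IndepFun X Y μ := by
  have hle (j : ℕ ⊕ ℕ × ℕ) : MeasurableSpace.comap
      (Sum.elim D (fun q : ℕ × ℕ => ξ q.1 q.2) j) inferInstance ≤ ‹MeasurableSpace Ω› := by
    rcases j with n | ⟨n, l⟩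
    · exact (H.measurable_demand n).comap_le
    · exact (H.measurable_stay n l).comap_le
  exact indep_of_indep_of_le_left (indep_of_indep_of_le_right
    (indep_iSup_of_disjoint hle H.indep hST) hY.comap_le) hX.comap_le

omit [IsProbabilityMeasure μ] in
theorem indepFun_state_demand (H : IsPrimitives μ p D ξ) (n : ℕ) :
    IndepFun (state D ξ π I₁ B₀ n) (D n) μ := by
  refine H.indepFun_of_disjoint (S := past n) (T := {Sum.inl n}) ?_
    (measurable_info_state n subset_rfl) (measurable_info_demand rfl)
  simp [past]

omit [IsProbabilityMeasure μ] in
theorem indepFun_unmet_stay (H : IsPrimitives μ p D ξ) (n l : ℕ) :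
    IndepFun (unmet D ξ π I₁ B₀ n) (ξ n l) μ := by
  refine H.indepFun_of_disjoint (S := past n ∪ {Sum.inl n}) (T := {Sum.inr (n, l)}) ?_
    (measurable_unmet n (measurable_info_state n Set.subset_union_left)
      (measurable_info_demand (by simp))) (measurable_info_stay rfl)
  simp [past]

omit [IsProbabilityMeasure μ] in
theorem measurable_state (H : IsPrimitives μ p D ξ) (n : ℕ) :
    Measurable (state D ξ π I₁ B₀ n) :=
  PartialBackorder.measurable_state n (fun k _ => H.measurable_demand k)
    (fun k _ l => H.measurable_stay k l)

omit [IsProbabilityMeasure μ] in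
theorem measurable_backorder (H : IsPrimitives μ p D ξ) (n : ℕ) :
    Measurable fun ω => (state D ξ π I₁ B₀ n ω).2 :=
  measurable_snd.comp (H.measurable_state n)

omit [IsProbabilityMeasure μ] in
theorem measurable_unmet (H : IsPrimitives μ p D ξ) (n : ℕ) :
    Measurable (unmet D ξ π I₁ B₀ n) :=
  PartialBackorder.measurable_unmet n (H.measurable_state n) (H.measurable_demand n)

theorem lintegral_stay (H : IsPrimitives μ p D ξ) (hp0 : 0 ≤ p) (hp1 : p ≤ 1) (n l : ℕ) :
    ∫⁻ ω, (ξ n l ω : ENNReal) ∂μ = ENNReal.ofReal p := by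
  have hm1 : MeasurableSet {ω | ξ n l ω = 1} := H.measurable_stay n l (measurableSet_singleton 1)
  have hm0 : MeasurableSet {ω | ξ n l ω = 0} := H.measurable_stay n l (measurableSet_singleton 0)
  have hdisj : Disjoint {ω | ξ n l ω = 1} {ω | ξ n l ω = 0} := by
    rw [Set.disjoint_left]
    intro ω (h1 : _ = 1) (h0 : _ = 0)
    omega
  -- The two prescribed masses add up to `1`, so almost surely the variable is the indicator of the
  -- value `1`.
  have hae : ∀ᵐ ω ∂μ, ω ∈ {ω | ξ n l ω = 1} ∪ {ω | ξ n l ω = 0} := by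
    refine (mem_ae_iff_prob_eq_one (hm1.union hm0)).2 ?_
    rw [measure_union hdisj hm0, H.stay_one, H.stay_zero, ← ENNReal.ofReal_add hp0 (by linarith)]
    simp
  rw [← H.stay_one n l, ← lintegral_indicator_one hm1]
  refine lintegral_congr_ae (hae.mono fun ω hω => ?_)
  rcases hω with hω | hω
  · rw [Set.indicator_of_mem hω]
    simp [show ξ n l ω = 1 from hω]
  · rw [Set.indicator_of_notMem (Set.disjoint_right.1 hdisj hω)]
    simp [show ξ n l ω = 0 from hω]

omit [IsProbabilityMeasure μ] in
theorem integrable_demand_nat (H : IsPrimitives μ p D ξ) (n : ℕ) :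
    Integrable (fun ω => (D n ω : ℝ)) μ :=
  ((H.identDistrib_demand n).comp (u := fun k : ℕ => (k : ℝ)) .of_discrete).integrable_iff.2
    H.integrable_demand

omit [IsProbabilityMeasure μ] in
theorem integral_comp_demand (H : IsPrimitives μ p D ξ) (n : ℕ) (f : ℕ → ℝ) :
    ∫ ω, f (D n ω) ∂μ = ∫ ω, f (D 0 ω) ∂μ :=
  ((H.identDistrib_demand n).comp (u := f) .of_discrete).integral_eq

/-- Stated in `ENNReal` because integrability of the next backorder is deduced from it. -/
theorem lintegral_backorder_succ (H : IsPrimitives μ p D ξ) (hp0 : 0 ≤ p) (hp1 : p ≤ 1) (n : ℕ) :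
    ∫⁻ ω, ((state D ξ π I₁ B₀ (n + 1) ω).2 : ENNReal) ∂μ =
      ENNReal.ofReal p * ∫⁻ ω, (unmet D ξ π I₁ B₀ n ω : ENNReal) ∂μ := by
  simp_rw [backorder_succ]
  exact lintegral_sum_range_of_indepFun (H.measurable_unmet n) (H.measurable_stay n)
    (H.indepFun_unmet_stay n) (H.lintegral_stay hp0 hp1 n)

omit [IsProbabilityMeasure μ] in
theorem integrable_natCast_iff {f : Ω → ℕ} (hf : Measurable f) :
    Integrable (fun ω => (f ω : ℝ)) μ ↔ ∫⁻ ω, (f ω : ENNReal) ∂μ ≠ ⊤ := by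
  have hm : AEStronglyMeasurable (fun ω => (f ω : ℝ)) μ :=
    (Measurable.of_discrete (f := fun k : ℕ => (k : ℝ)) |>.comp hf).aestronglyMeasurable
  rw [Integrable, and_iff_right hm, hasFiniteIntegral_iff_ofReal (.of_forall fun ω => by positivity),
    lt_top_iff_ne_top]
  simp

omit [IsProbabilityMeasure μ] in
theorem integral_natCast {f : Ω → ℕ} (hf : Measurable f) :
    ∫ ω, (f ω : ℝ) ∂μ = (∫⁻ ω, (f ω : ENNReal) ∂μ).toReal := by
  have hm : AEStronglyMeasurable (fun ω => (f ω : ℝ)) μ :=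
    (Measurable.of_discrete (f := fun k : ℕ => (k : ℝ)) |>.comp hf).aestronglyMeasurable
  rw [integral_eq_lintegral_of_nonneg_ae (.of_forall fun ω => by positivity) hm]
  simp

omit [IsProbabilityMeasure μ] in
theorem integrable_unmet_of_backorder (H : IsPrimitives μ p D ξ) {n : ℕ}
    (hB : Integrable (fun ω => ((state D ξ π I₁ B₀ n ω).2 : ℝ)) μ) :
    Integrable (fun ω => (unmet D ξ π I₁ B₀ n ω : ℝ)) μ := by
  refine (hB.fun_add (H.integrable_demand_nat n)).mono'
    (Measurable.of_discrete (f := fun k : ℕ => (k : ℝ)) |>.comp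
      (H.measurable_unmet n)).aestronglyMeasurable (.of_forall fun ω => ?_)
  rw [Real.norm_of_nonneg (by positivity)]
  have : unmet D ξ π I₁ B₀ n ω ≤ (state D ξ π I₁ B₀ n ω).2 + D n ω := Nat.sub_le _ _
  exact_mod_cast this

/-- Ordering only lowers `U ≤ B + D`, so mean backorders are finite under every policy, even when
holding costs are not. -/
theorem integrable_backorder (H : IsPrimitives μ p D ξ) (hp0 : 0 ≤ p) (hp1 : p ≤ 1) (n : ℕ) :
    Integrable (fun ω => ((state D ξ π I₁ B₀ n ω).2 : ℝ)) μ := by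
  induction n with
  | zero => exact integrable_const (B₀ : ℝ)
  | succ n ih =>
    have hU := H.integrable_unmet_of_backorder ih
    rw [integrable_natCast_iff (H.measurable_unmet n)] at hU
    rw [integrable_natCast_iff (H.measurable_backorder (n + 1)),
      H.lintegral_backorder_succ hp0 hp1]
    exact ENNReal.mul_ne_top ENNReal.ofReal_ne_top hU

theorem integrable_unmet (H : IsPrimitives μ p D ξ) (hp0 : 0 ≤ p) (hp1 : p ≤ 1) (n : ℕ) :
    Integrable (fun ω => (unmet D ξ π I₁ B₀ n ω : ℝ)) μ :=
  H.integrable_unmet_of_backorder (H.integrable_backorder hp0 hp1 n)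

theorem integral_backorder_succ (H : IsPrimitives μ p D ξ) (hp0 : 0 ≤ p) (hp1 : p ≤ 1) (n : ℕ) :
    ∫ ω, ((state D ξ π I₁ B₀ (n + 1) ω).2 : ℝ) ∂μ = p * ∫ ω, (unmet D ξ π I₁ B₀ n ω : ℝ) ∂μ := by
  rw [integral_natCast (H.measurable_unmet n),
    integral_natCast (H.measurable_backorder (n + 1)),
    H.lintegral_backorder_succ hp0 hp1, ENNReal.toReal_mul, ENNReal.toReal_ofReal hp0]

/-- The unmet demand as a function of the state and the demand. -/
def unmetOf (π : Policy) (n : ℕ) (q : (ℕ × ℕ) × ℕ) : ℝ :=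
  max ((q.2 : ℝ) - ((q.1.1 : ℝ) + π n q.1.1 q.1.2 - q.1.2)) 0

omit [IsProbabilityMeasure μ] in
theorem integral_unmetOf_eq_shortfall (H : IsPrimitives μ p D ξ) (n : ℕ) (ω : Ω) :
    ∫ ω', unmetOf π n (state D ξ π I₁ B₀ n ω, D n ω') ∂μ =
      shortfall μ D (position D ξ π I₁ B₀ n ω) :=
  H.integral_comp_demand n fun k => unmetOf π n (state D ξ π I₁ B₀ n ω, k)

theorem integrable_unmetOf (H : IsPrimitives μ p D ξ) (hp0 : 0 ≤ p) (hp1 : p ≤ 1) (n : ℕ) :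
    Integrable (fun ω => unmetOf π n (state D ξ π I₁ B₀ n ω, D n ω)) μ :=
  (H.integrable_unmet hp0 hp1 n).congr (.of_forall fun ω => unmet_eq_max n ω)

theorem integrable_shortfall_position (H : IsPrimitives μ p D ξ) (hp0 : 0 ≤ p) (hp1 : p ≤ 1)
    (n : ℕ) : Integrable (fun ω => shortfall μ D (position D ξ π I₁ B₀ n ω)) μ := by
  simp_rw [← H.integral_unmetOf_eq_shortfall n]
  exact integrable_integral_of_indepFun (H.measurable_state n) (H.measurable_demand n)
    (H.indepFun_state_demand n) .of_discrete (H.integrable_unmetOf hp0 hp1 n)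

theorem integral_shortfall_position (H : IsPrimitives μ p D ξ) (hp0 : 0 ≤ p) (hp1 : p ≤ 1)
    (n : ℕ) : ∫ ω, shortfall μ D (position D ξ π I₁ B₀ n ω) ∂μ =
      ∫ ω, (unmet D ξ π I₁ B₀ n ω : ℝ) ∂μ := by
  simp_rw [← H.integral_unmetOf_eq_shortfall n, unmet_eq_max]
  exact (integral_eq_integral_integral_of_indepFun (H.measurable_state n) (H.measurable_demand n)
    (H.indepFun_state_demand n) .of_discrete (H.integrable_unmetOf hp0 hp1 n)).symm

/-! ### Decomposition of the profit -/

/-- Sales are `B + D - U`. A unit of unmet demand forfeits `r` now, of which the expected share `p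
r` is carried over through the backorder. -/
theorem periodProfit_eq (H : IsPrimitives μ p D ξ) (n I B Q : ℕ) :
    periodProfit μ r h D n I B Q = (r * B - r * p * shortfall μ D ((I : ℝ) + Q - B))
      + (r * ∫ ω, (D 0 ω : ℝ) ∂μ - newsvendorCost μ ((1 - p) * r) h D ((I : ℝ) + Q - B)) := by
  have hL := integrable_shortfall H.integrable_demand ((I : ℝ) + Q - B)
  have hC := integrable_newsvendorCost (b := (1 - p) * r) (h := h) H.integrable_demand
    ((I : ℝ) + Q - B)
  rw [periodProfit, H.integral_comp_demand n fun k =>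
    r * min ((I : ℝ) + Q) ((B : ℝ) + k) - h * max ((I : ℝ) + Q - B - k) 0, shortfall,
    newsvendorCost, ← integral_const_mul, ← integral_const_mul,
    ← integral_sub (H.integrable_demand.const_mul r) hC]
  have hconst : r * (B : ℝ) = ∫ _, r * (B : ℝ) ∂μ := by simp
  have h1 : Integrable (fun ω => r * (B : ℝ)
      - r * p * max ((D 0 ω : ℝ) - ((I : ℝ) + Q - B)) 0) μ :=
    (integrable_const _).sub (hL.const_mul _)
  have h2 : Integrable (fun ω => r * (D 0 ω : ℝ) - ((1 - p) * r * max ((D 0 ω : ℝ)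
      - ((I : ℝ) + Q - B)) 0 + h * max ((I : ℝ) + Q - B - D 0 ω) 0)) μ :=
    (H.integrable_demand.const_mul r).sub hC
  rw [hconst, ← integral_sub (integrable_const _) (hL.const_mul _), ← integral_add h1 h2]
  congr 1 with ω
  have : min ((I : ℝ) + Q) ((B : ℝ) + D 0 ω)
      = (B : ℝ) + D 0 ω - max ((D 0 ω : ℝ) - ((I : ℝ) + Q - B)) 0 := by
    rcases le_total ((I : ℝ) + Q) ((B : ℝ) + D 0 ω) with hle | hle
    · rw [min_eq_left hle, max_eq_left (by linarith)]; ring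
    · rw [min_eq_right hle, max_eq_right (by linarith)]; ring
  rw [this]
  ring

/-- The part of the total profit that telescopes in expectation. -/
def transferProfit (μ : Measure Ω) (p r : ℝ) (D : ℕ → Ω → ℕ) (ξ : ℕ → ℕ → Ω → ℕ) (π : Policy)
    (I₁ B₀ N : ℕ) (ω : Ω) : ℝ :=
  ∑ n ∈ Finset.range N, (r * ((state D ξ π I₁ B₀ n ω).2 : ℝ)
    - r * p * shortfall μ D (position D ξ π I₁ B₀ n ω))

theorem totalProfit_eq (H : IsPrimitives μ p D ξ) (N : ℕ) (ω : Ω) :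
    totalProfit μ r h D ξ π I₁ B₀ N ω = transferProfit μ p r D ξ π I₁ B₀ N ω
      + ∑ n ∈ Finset.range N, (r * ∫ ω, (D 0 ω : ℝ) ∂μ
        - newsvendorCost μ ((1 - p) * r) h D (position D ξ π I₁ B₀ n ω)) := by
  rw [totalProfit, transferProfit, ← Finset.sum_add_distrib]
  exact Finset.sum_congr rfl fun n _ => H.periodProfit_eq n _ _ _

theorem integrable_transferProfit (H : IsPrimitives μ p D ξ) (hp0 : 0 ≤ p) (hp1 : p ≤ 1)
    (N : ℕ) : Integrable (transferProfit μ p r D ξ π I₁ B₀ N) μ :=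
  integrable_finsetSum _ fun n _ => ((H.integrable_backorder hp0 hp1 n).const_mul r).sub
    ((H.integrable_shortfall_position hp0 hp1 n).const_mul (r * p))

/-- Given the state, the shortfall is the mean of `U`, and `r p E[U]` is `r` times the mean of the
next backorder. -/
theorem integral_transferProfit (H : IsPrimitives μ p D ξ) (hp0 : 0 ≤ p) (hp1 : p ≤ 1) (N : ℕ) :
    ∫ ω, transferProfit μ p r D ξ π I₁ B₀ N ω ∂μ =
      r * B₀ - r * ∫ ω, ((state D ξ π I₁ B₀ N ω).2 : ℝ) ∂μ := by
  induction N with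
  | zero => simp [transferProfit, state]
  | succ N ih =>
    have hB := (H.integrable_backorder (π := π) (I₁ := I₁) (B₀ := B₀) hp0 hp1 N).const_mul r
    have hL := (H.integrable_shortfall_position (π := π) (I₁ := I₁) (B₀ := B₀) hp0 hp1
      N).const_mul (r * p)
    have hBL : Integrable (fun ω => r * ((state D ξ π I₁ B₀ N ω).2 : ℝ)
        - r * p * shortfall μ D (position D ξ π I₁ B₀ N ω)) μ := hB.sub hL
    have : ∫ ω, transferProfit μ p r D ξ π I₁ B₀ (N + 1) ω ∂μ =
        ∫ ω, transferProfit μ p r D ξ π I₁ B₀ N ω ∂μ +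
          ∫ ω, (r * ((state D ξ π I₁ B₀ N ω).2 : ℝ)
            - r * p * shortfall μ D (position D ξ π I₁ B₀ N ω)) ∂μ := by
      rw [← integral_add (H.integrable_transferProfit hp0 hp1 N) hBL]
      simp only [transferProfit, Finset.sum_range_succ]
    rw [this, ih, integral_sub hB hL, integral_const_mul, integral_const_mul,
      H.integral_shortfall_position hp0 hp1, H.integral_backorder_succ hp0 hp1]
    ring

/-! ### Bounds on the long-run average profit -/

theorem avgProfit_le (H : IsPrimitives μ p D ξ) (hp0 : 0 ≤ p) (hp1 : p ≤ 1) (hr : 0 ≤ r) {c : ℝ}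
    (hc : ∀ n, ∀ᵐ ω ∂μ, c ≤ newsvendorCost μ ((1 - p) * r) h D (position D ξ π I₁ B₀ n ω)) :
    avgProfit μ r h D ξ π I₁ B₀ ≤ ((r * ∫ ω, (D 0 ω : ℝ) ∂μ - c : ℝ) : EReal) := by
  refine liminf_div_le (c := r * B₀) fun N => ?_
  have hint := H.integrable_transferProfit (r := r) (π := π) (I₁ := I₁) (B₀ := B₀) hp0 hp1 N
  set g := r * ∫ ω, (D 0 ω : ℝ) ∂μ - c
  calc expect μ (totalProfit μ r h D ξ π I₁ B₀ N)
      -- The newsvendor cost along the path may fail to be integrable, so it is replaced by its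
      -- lower bound before integrating.
      ≤ expect μ fun ω => transferProfit μ p r D ξ π I₁ B₀ N ω + N * g := by
        refine expect_mono ((ae_all_iff.2 hc).mono fun ω hω => ?_)
        rw [H.totalProfit_eq]
        gcongr
        refine (Finset.sum_le_card_nsmul _ _ g fun n _ => ?_).trans_eq (by simp)
        exact sub_le_sub_left (hω n) _
    _ = ((r * B₀ - r * ∫ ω, ((state D ξ π I₁ B₀ N ω).2 : ℝ) ∂μ + N * g : ℝ) : EReal) := by
        rw [expect_of_integrable (hint.fun_add (integrable_const _)),
          integral_add hint (integrable_const _), H.integral_transferProfit hp0 hp1]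
        simp
    _ ≤ _ := by
        have : 0 ≤ r * ∫ ω, ((state D ξ π I₁ B₀ N ω).2 : ℝ) ∂μ :=
          mul_nonneg hr (integral_nonneg fun ω => by positivity)
        exact EReal.coe_le_coe_iff.2 (by linarith)

/-- Here `e n` is the loss of period `n` against the target cost `c`; a bounded total expected loss
does not affect the average. -/
theorem le_avgProfit (H : IsPrimitives μ p D ξ) (hp0 : 0 ≤ p) (hp1 : p ≤ 1) (hr : 0 ≤ r)
    {c K K' : ℝ} {e : ℕ → Ω → ℝ} (he : ∀ n, Integrable (e n) μ)
    (hK : ∀ n, ∫ ω, ((state D ξ π I₁ B₀ n ω).2 : ℝ) ∂μ ≤ K)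
    (hK' : ∀ N, ∑ n ∈ Finset.range N, ∫ ω, e n ω ∂μ ≤ K')
    (hc : ∀ n, ∀ᵐ ω ∂μ,
      newsvendorCost μ ((1 - p) * r) h D (position D ξ π I₁ B₀ n ω) ≤ c + e n ω) :
    ((r * ∫ ω, (D 0 ω : ℝ) ∂μ - c : ℝ) : EReal) ≤ avgProfit μ r h D ξ π I₁ B₀ := by
  refine le_liminf_div (c := r * B₀ - r * K - K') fun N => ?_
  have hint := H.integrable_transferProfit (r := r) (π := π) (I₁ := I₁) (B₀ := B₀) hp0 hp1 N
  have hsum : Integrable (fun ω => ∑ n ∈ Finset.range N, e n ω) μ :=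
    integrable_finsetSum _ fun n _ => he n
  set g := r * ∫ ω, (D 0 ω : ℝ) ∂μ - c with hg
  have hge : Integrable (fun ω => N * g - ∑ n ∈ Finset.range N, e n ω) μ :=
    (integrable_const _).sub hsum
  calc ((r * B₀ - r * K - K' + N * g : ℝ) : EReal)
      ≤ ((r * B₀ - r * ∫ ω, ((state D ξ π I₁ B₀ N ω).2 : ℝ) ∂μ
          + (N * g - ∑ n ∈ Finset.range N, ∫ ω, e n ω ∂μ) : ℝ) : EReal) := by
        have := mul_le_mul_of_nonneg_left (hK N) hr
        exact EReal.coe_le_coe_iff.2 (by linarith [hK' N])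
    _ = expect μ fun ω => transferProfit μ p r D ξ π I₁ B₀ N ω
          + (N * g - ∑ n ∈ Finset.range N, e n ω) := by
        rw [expect_of_integrable (hint.fun_add hge),
          integral_add hint hge, H.integral_transferProfit hp0 hp1,
          integral_sub (integrable_const _) hsum, integral_finsetSum _ fun n _ => he n]
        simp
    _ ≤ expect μ (totalProfit μ r h D ξ π I₁ B₀ N) := by
        refine expect_mono ((ae_all_iff.2 hc).mono fun ω hω => ?_)
        rw [H.totalProfit_eq]
        gcongr
        have : (N : ℝ) * g - ∑ n ∈ Finset.range N, e n ω
            = ∑ n ∈ Finset.range N, (g - e n ω) := by simp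
        rw [this]
        refine Finset.sum_le_sum fun n _ => ?_
        linarith [hω n]

end IsPrimitives

/-! ### Base-stock policies -/

section BaseStock

variable {Ω : Type*} {D : ℕ → Ω → ℕ} {ξ : ℕ → ℕ → Ω → ℕ} {I₁ B₀ s : ℕ}

/-- The amount by which the inventory position exceeds the base-stock level before ordering. -/
def excess (D : ℕ → Ω → ℕ) (ξ : ℕ → ℕ → Ω → ℕ) (s I₁ B₀ n : ℕ) (ω : Ω) : ℕ :=
  (state D ξ (baseStock s) I₁ B₀ n ω).1 - ((state D ξ (baseStock s) I₁ B₀ n ω).2 + s)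

/-- Ordering up to `s` raises stock to `max I (B + s)`; the last summand is the excess. -/
theorem add_baseStock (n I B : ℕ) : I + baseStock s n I B = B + s + (I - (B + s)) := by
  simp only [baseStock]
  omega

theorem position_baseStock (n : ℕ) (ω : Ω) :
    position D ξ (baseStock s) I₁ B₀ n ω = s + excess D ξ s I₁ B₀ n ω := by
  rw [position, excess, ← Nat.cast_add, add_baseStock]
  push_cast
  ring

theorem unmet_baseStock_le (n : ℕ) (ω : Ω) : unmet D ξ (baseStock s) I₁ B₀ n ω ≤ D n ω := by
  rw [unmet, add_baseStock]
  omega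

theorem excess_succ_le (n : ℕ) (ω : Ω) :
    excess D ξ s I₁ B₀ (n + 1) ω ≤ excess D ξ s I₁ B₀ n ω - D n ω := by
  rw [excess, inventory_succ, add_baseStock, ← excess]
  omega

theorem excess_le (n : ℕ) (ω : Ω) : excess D ξ s I₁ B₀ n ω ≤ I₁ - (B₀ + s) := by
  induction n with
  | zero => exact le_rfl
  | succ n ih => exact (excess_succ_le n ω).trans ((Nat.sub_le _ _).trans ih)

/-- Without demand a positive inventory never decreases, whatever the policy is. -/
theorem state_of_no_demand {π : Policy} {ω : Ω} (hω : ∀ n, D n ω = 0) (n : ℕ) :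
    I₁ ≤ (state D ξ π I₁ 0 n ω).1 ∧ (state D ξ π I₁ 0 n ω).2 = 0 := by
  induction n with
  | zero => exact ⟨le_rfl, rfl⟩
  | succ n ih =>
    rw [inventory_succ, backorder_succ, unmet, ih.2, hω n]
    exact ⟨by omega, by simp⟩

end BaseStock

/-! ### Decay of the excess and optimality -/

namespace IsPrimitives

variable {Ω : Type*} [MeasurableSpace Ω] {μ : Measure Ω} [IsProbabilityMeasure μ] {p : ℝ}
  {D : ℕ → Ω → ℕ} {ξ : ℕ → ℕ → Ω → ℕ} {I₁ B₀ s : ℕ} {r h : ℝ}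

theorem integrable_excess (H : IsPrimitives μ p D ξ) (n : ℕ) :
    Integrable (fun ω => (excess D ξ s I₁ B₀ n ω : ℝ)) μ := by
  have hm : Measurable fun q : ℕ × ℕ => ((q.1 - (q.2 + s) : ℕ) : ℝ) := .of_discrete
  refine .of_bound (hm.comp (H.measurable_state n)).aestronglyMeasurable ((I₁ - (B₀ + s) : ℕ) : ℝ)
    (.of_forall fun ω => ?_)
  rw [Real.norm_of_nonneg (by positivity)]
  exact_mod_cast excess_le n ω

theorem integral_backorder_baseStock_le (H : IsPrimitives μ p D ξ) (hp0 : 0 ≤ p) (hp1 : p ≤ 1)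
    (n : ℕ) : ∫ ω, ((state D ξ (baseStock s) I₁ B₀ n ω).2 : ℝ) ∂μ ≤
      B₀ + ∫ ω, (D 0 ω : ℝ) ∂μ := by
  have hD : 0 ≤ ∫ ω, (D 0 ω : ℝ) ∂μ := integral_nonneg fun ω => by positivity
  cases n with
  | zero => simpa [state] using hD
  | succ n =>
    have h1 : ∫ ω, (unmet D ξ (baseStock s) I₁ B₀ n ω : ℝ) ∂μ ≤ ∫ ω, (D 0 ω : ℝ) ∂μ := by
      rw [← H.integral_comp_demand n fun k => (k : ℝ)]
      exact integral_mono (H.integrable_unmet hp0 hp1 n) (H.integrable_demand_nat n)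
        fun ω => Nat.cast_le.2 (unmet_baseStock_le n ω)
    have h2 : 0 ≤ ∫ ω, (unmet D ξ (baseStock s) I₁ B₀ n ω : ℝ) ∂μ :=
      integral_nonneg fun ω => by positivity
    rw [H.integral_backorder_succ hp0 hp1]
    have h3 := mul_le_of_le_one_left h2 hp1
    have h4 : (0 : ℝ) ≤ B₀ := by positivity
    linarith

/-- The expected excess decreases at least in proportion to itself and to the probability of a
positive demand. -/
theorem mul_integral_excess_le (H : IsPrimitives μ p D ξ) (n : ℕ) :
    μ.real {ω | 0 < D 0 ω} * ∫ ω, (excess D ξ s I₁ B₀ n ω : ℝ) ∂μ ≤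
      ((I₁ - (B₀ + s) : ℕ) : ℝ) * (∫ ω, (excess D ξ s I₁ B₀ n ω : ℝ) ∂μ
        - ∫ ω, (excess D ξ s I₁ B₀ (n + 1) ω : ℝ) ∂μ) := by
  set f : ℕ × ℕ → ℝ := fun q => ((q.1 - (q.2 + s) : ℕ) : ℝ)
  set g : ℕ → ℝ := fun k => if 0 < k then 1 else 0
  have hf : Measurable f := .of_discrete
  have hg : Measurable g := .of_discrete
  have hind : IndepFun (fun ω => f (state D ξ (baseStock s) I₁ B₀ n ω)) (fun ω => g (D n ω)) μ :=
    (H.indepFun_state_demand n).comp hf hg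
  have hfS := hf.comp (H.measurable_state (π := baseStock s) (I₁ := I₁) (B₀ := B₀) n)
  have hgD := hg.comp (H.measurable_demand n)
  have hgint : ∫ ω, g (D n ω) ∂μ = μ.real {ω | 0 < D 0 ω} := by
    rw [H.integral_comp_demand n g, ← integral_indicator_one
      (show MeasurableSet {ω | 0 < D 0 ω} from H.measurable_demand 0 measurableSet_Ioi)]
    congr 1 with ω
    simp [g, Set.indicator_apply]
  have hprod : ∫ ω, (excess D ξ s I₁ B₀ n ω : ℝ) * g (D n ω) ∂μ =
      (∫ ω, (excess D ξ s I₁ B₀ n ω : ℝ) ∂μ) * μ.real {ω | 0 < D 0 ω} := by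
    rw [← hgint]
    exact hind.integral_fun_mul_eq_mul_integral hfS.aestronglyMeasurable hgD.aestronglyMeasurable
  -- The excess never exceeds its initial value `M`, and a positive demand lowers a positive excess
  -- by at least `1`, so the drop times `M` dominates it.
  have hle (ω : Ω) : (excess D ξ s I₁ B₀ n ω : ℝ) * g (D n ω) ≤ ((I₁ - (B₀ + s) : ℕ) : ℝ)
      * ((excess D ξ s I₁ B₀ n ω : ℝ) - excess D ξ s I₁ B₀ (n + 1) ω) := by
    have h1 := excess_succ_le (D := D) (ξ := ξ) (s := s) (I₁ := I₁) (B₀ := B₀) n ω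
    have h2 := excess_le (D := D) (ξ := ξ) (s := s) (I₁ := I₁) (B₀ := B₀) n ω
    have h3 : (excess D ξ s I₁ B₀ (n + 1) ω : ℝ) ≤ excess D ξ s I₁ B₀ n ω := by
      exact_mod_cast h1.trans (Nat.sub_le _ _)
    have h4 : 0 ≤ ((I₁ - (B₀ + s) : ℕ) : ℝ)
      * ((excess D ξ s I₁ B₀ n ω : ℝ) - excess D ξ s I₁ B₀ (n + 1) ω) :=
      mul_nonneg (by positivity) (sub_nonneg.2 h3)
    by_cases hD : 0 < D n ω
    · rcases Nat.eq_zero_or_pos (excess D ξ s I₁ B₀ n ω) with h0 | h0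
      · rw [h0] at h4 ⊢
        simpa using h4
      · have h5 : (excess D ξ s I₁ B₀ (n + 1) ω : ℝ) + 1 ≤ excess D ξ s I₁ B₀ n ω := by
          have : excess D ξ s I₁ B₀ (n + 1) ω + 1 ≤ excess D ξ s I₁ B₀ n ω := by omega
          exact_mod_cast this
        have h6 : (excess D ξ s I₁ B₀ n ω : ℝ) ≤ ((I₁ - (B₀ + s) : ℕ) : ℝ) := by exact_mod_cast h2
        simp only [g, if_pos hD, mul_one]
        exact h6.trans (le_mul_of_one_le_right (by positivity) (by linarith))
    · simpa only [g, if_neg hD, mul_zero] using h4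
  have hE := H.integrable_excess (s := s) (I₁ := I₁) (B₀ := B₀) n
  have hE' := H.integrable_excess (s := s) (I₁ := I₁) (B₀ := B₀) (n + 1)
  rw [mul_comm, ← hprod, ← integral_sub hE hE', ← integral_const_mul]
  refine integral_mono (hE.mul_bdd (c := 1) hgD.aestronglyMeasurable (.of_forall fun ω => ?_))
    ((hE.sub hE').const_mul _) hle
  simp only [g]
  split_ifs <;> simp

/-- The drops telescope to at most `M`, the initial excess. -/
theorem sum_integral_excess_le (H : IsPrimitives μ p D ξ) (N : ℕ) :
    μ.real {ω | 0 < D 0 ω} * ∑ n ∈ Finset.range N, ∫ ω, (excess D ξ s I₁ B₀ n ω : ℝ) ∂μ ≤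
      ((I₁ - (B₀ + s) : ℕ) : ℝ) * ((I₁ - (B₀ + s) : ℕ) : ℝ) := by
  rw [Finset.mul_sum]
  refine (Finset.sum_le_sum fun n _ => H.mul_integral_excess_le n).trans ?_
  rw [← Finset.mul_sum, Finset.sum_range_sub']
  refine mul_le_mul_of_nonneg_left ?_ (by positivity)
  have h0 : ∫ ω, (excess D ξ s I₁ B₀ 0 ω : ℝ) ∂μ = ((I₁ - (B₀ + s) : ℕ) : ℝ) := by
    simp [excess, state]
  have hN : 0 ≤ ∫ ω, (excess D ξ s I₁ B₀ N ω : ℝ) ∂μ := integral_nonneg fun ω => by positivity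
  linarith

/-- Unless there is no demand and too much initial inventory, a base-stock policy earns the
newsvendor profit of its level. -/
theorem le_avgProfit_baseStock (H : IsPrimitives μ p D ξ) (hp0 : 0 ≤ p) (hp1 : p ≤ 1)
    (hr : 0 ≤ r) (hh : 0 ≤ h) (hpos : 0 < μ.real {ω | 0 < D 0 ω} ∨ I₁ ≤ B₀ + s) :
    ((r * ∫ ω, (D 0 ω : ℝ) ∂μ - newsvendorCost μ ((1 - p) * r) h D s : ℝ) : EReal) ≤
      avgProfit μ r h D ξ (baseStock s) I₁ B₀ := by
  obtain ⟨K, hK⟩ : ∃ K : ℝ, ∀ N,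
      ∑ n ∈ Finset.range N, ∫ ω, (excess D ξ s I₁ B₀ n ω : ℝ) ∂μ ≤ K := by
    rcases hpos with hq | hle
    · refine ⟨((I₁ - (B₀ + s) : ℕ) : ℝ) * ((I₁ - (B₀ + s) : ℕ) : ℝ) / μ.real {ω | 0 < D 0 ω},
        fun N => ?_⟩
      rw [le_div_iff₀' hq]
      exact H.sum_integral_excess_le N
    · refine ⟨0, fun N => (Finset.sum_eq_zero fun n _ => ?_).le⟩
      have (ω : Ω) : excess D ξ s I₁ B₀ n ω = 0 := by
        have := excess_le (D := D) (ξ := ξ) (s := s) (I₁ := I₁) (B₀ := B₀) n ω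
        omega
      simp [this]
  refine H.le_avgProfit hp0 hp1 hr (e := fun n ω => h * excess D ξ s I₁ B₀ n ω) (K' := h * K)
    (fun n => (H.integrable_excess n).const_mul h)
    (H.integral_backorder_baseStock_le hp0 hp1) (fun N => ?_) fun n => .of_forall fun ω => ?_
  · simp_rw [integral_const_mul, ← Finset.mul_sum]
    exact mul_le_mul_of_nonneg_left (hK N) hh
  · rw [position_baseStock]
    refine (newsvendorCost_sub_le (mul_nonneg (by linarith) hr) hh H.integrable_demand
      (le_add_of_nonneg_right (by positivity))).trans_eq ?_
    ring

theorem ae_no_demand (H : IsPrimitives μ p D ξ) (h0 : μ.real {ω | 0 < D 0 ω} = 0) :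
    ∀ᵐ ω ∂μ, ∀ n, D n ω = 0 := by
  refine ae_all_iff.2 fun n => ?_
  have h1 : μ {ω | 0 < D n ω} = 0 := by
    rw [measureReal_eq_zero_iff] at h0
    exact ((H.identDistrib_demand n).measure_mem_eq measurableSet_Ioi).trans h0
  refine measure_mono_null (fun ω hω => ?_) h1
  exact Nat.pos_of_ne_zero hω

theorem isOptimal_baseStock (H : IsPrimitives μ p D ξ) (hp0 : 0 ≤ p) (hp1 : p ≤ 1) (hr : 0 ≤ r)
    (hh : 0 < h)
    (hs : IsLeast {x : ℕ | (1 - p) * r / ((1 - p) * r + h) ≤ μ.real {ω | D 0 ω ≤ x}} s) :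
    IsOptimal μ r h D ξ (baseStock s) := by
  intro I₁ B₀ hIB π
  have hb : 0 ≤ (1 - p) * r := mul_nonneg (by linarith) hr
  by_cases hpos : 0 < μ.real {ω | 0 < D 0 ω} ∨ I₁ ≤ B₀ + s
  · exact (H.avgProfit_le hp0 hp1 hr fun n => .of_forall fun ω => newsvendorCost_min hb hh
      (H.measurable_demand 0) H.integrable_demand hs _).trans
      (H.le_avgProfit_baseStock hp0 hp1 hr hh.le hpos)
  -- What remains is zero demand with `I₁` above the level, where the benchmark `G(s)` is
  -- unattainable and `G(I₁)` replaces it.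
  push Not at hpos
  obtain ⟨hq, hI⟩ := hpos
  -- Here `I₁ > 0`, so `I₁ * B₀ = 0` rules out initial backorders.
  obtain rfl : B₀ = 0 := (Nat.mul_eq_zero.1 hIB).resolve_left (by omega)
  have hae := H.ae_no_demand (le_antisymm hq measureReal_nonneg)
  -- As `I₁` exceeds `s`, the fractile inequality passes to `I₁`, so `G` does not fall below `G(I₁)`
  -- at higher positions.
  have hfrac : (1 - p) * r / ((1 - p) * r + h) ≤ μ.real {ω | D 0 ω ≤ I₁} :=
    hs.1.trans (measureReal_mono fun ω hω => le_trans (α := ℕ) hω (by omega))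
  refine (H.avgProfit_le (c := newsvendorCost μ ((1 - p) * r) h D I₁) hp0 hp1 hr
    fun n => ?_).trans (H.le_avgProfit hp0 hp1 hr (e := fun _ _ => 0) (K' := 0)
      (fun _ => integrable_const 0) (H.integral_backorder_baseStock_le hp0 hp1) (by simp)
      fun n => ?_)
  · filter_upwards [hae] with ω hω
    obtain ⟨h1, h2⟩ := state_of_no_demand (ξ := ξ) (π := π) (I₁ := I₁) hω n
    refine newsvendorCost_mono_of_le hb hh (H.measurable_demand 0) H.integrable_demand hfrac ?_
    rw [position, h2]
    have h3 : (I₁ : ℝ) ≤ (state D ξ π I₁ 0 n ω).1 := by exact_mod_cast h1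
    have h4 : (0 : ℝ) ≤ (π n (state D ξ π I₁ 0 n ω).1 0 : ℝ) := by positivity
    simp only [Nat.cast_zero]
    linarith
  · filter_upwards [hae] with ω hω
    obtain ⟨h1, h2⟩ := state_of_no_demand (ξ := ξ) (π := baseStock s) (I₁ := I₁) hω n
    have h3 : excess D ξ s I₁ 0 n ω = I₁ - (0 + s) := by
      refine le_antisymm (excess_le n ω) ?_
      rw [excess, h2]
      omega
    rw [position_baseStock, h3, ← Nat.cast_add, add_zero]
    refine le_of_eq ?_
    congr 2
    omega

end IsPrimitives

end PartialBackorder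

end

theorem mainTheorem3 {Ω : Type*} [MeasurableSpace Ω] (μ : Measure Ω) [IsProbabilityMeasure μ]
    (p r h : ℝ) (hp0 : 0 ≤ p) (hp1 : p ≤ 1) (hr : 0 < r) (hh : 0 < h)
    (D : ℕ → Ω → ℕ) (ξ : ℕ → ℕ → Ω → ℕ) (hDξ : PartialBackorder.IsPrimitives μ p D ξ) :
    ∃ s : ℕ,
      IsLeast {x : ℕ | (1 - p) * r / ((1 - p) * r + h) ≤ μ.real {ω | D 0 ω ≤ x}} s ∧
      PartialBackorder.IsOptimal μ r h D ξ (PartialBackorder.baseStock (s : ℤ)) := by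
  obtain ⟨s, hs⟩ := PartialBackorder.exists_isLeast_fractile (μ := μ) (D := D)
    (mul_nonneg (sub_nonneg.2 hp1) hr.le) hh
  exact ⟨s, hs, hDξ.isOptimal_baseStock hp0 hp1 hr.le hh hs⟩
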